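/- For positive integers $m$ and $n$ let $G_{m,n}=\langle x,y \mid x^m=y^n\rangle$ be the group with two generators $x,y$ and the single defining relation $x^m=y^n$ (the $(m,n)$ torus knot group when $m,n\ge 2$ are coprime). Let $p,q,r,s$ be primes with $p<q$ and $r<s$. Then $G_{p,q}$ embeds in $G_{r,s}$, that is, there is an injective group homomorphism $G_{p,q}\to G_{r,s}$, if and only if $p=r$ and $q=s$. -/

import Mathlib

/-- The torus knot group `G_{p,q} = ⟨x, y | x ^ p = y ^ q⟩`, where the generators `x` and `y`
are indexed by `0` and `1` in `Fin 2`. -/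
abbrev TorusKnotGroup (p q : ℕ) : Type :=
  PresentedGroup
    ({FreeGroup.of 0 ^ p * (FreeGroup.of 1 ^ q)⁻¹} : Set (FreeGroup (Fin 2)))

/-! Compose an embedding of `TorusKnotGroup p q` into `TorusKnotGroup r s` with the quotient map to
the free product `CyclicProd r s`, whose kernel is central; the composite `φ` also has central
kernel. The images of the generators satisfy `φ x ^ p = φ y ^ q`. If this power were nontrivial,
`commute_of_pow_eq_pow` would make `φ x` and `φ y` commute, so the commutator of `x` and `y` would
be central, and `commute_of_commutator_mem_center` would make `x` and `y` commute, which they do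
not. Hence `φ x` and `φ y` have orders `p` and `q`. Torsion in a free product is conjugate into a
factor, so both primes lie in `{r, s}`, and the orderings decide. -/

namespace Monoid.CoprodI

/-! ### Reduced words and their powers -/

section Lists

variable {ι : Type*} {M : ι → Type*} [∀ i, Group (M i)]

/-- The product in the free product of a list of letters. -/
def listProd (l : List (Σ i, M i)) : CoprodI M := (l.map fun x => of x.2).prod

/-- A list of letters is reduced if no letter is trivial and adjacent letters come from
different factors. -/
def IsReduced (l : List (Σ i, M i)) : Prop :=
  (∀ x ∈ l, x.2 ≠ 1) ∧ l.IsChain fun x y => x.1 ≠ y.1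

@[simp] theorem listProd_nil : listProd ([] : List (Σ i, M i)) = 1 := rfl

@[simp] theorem listProd_cons (x : Σ i, M i) (l : List (Σ i, M i)) :
    listProd (x :: l) = of x.2 * listProd l := by simp [listProd]

@[simp] theorem listProd_append (l m : List (Σ i, M i)) :
    listProd (l ++ m) = listProd l * listProd m := by simp [listProd]

theorem listProd_flatten_replicate (n : ℕ) (l : List (Σ i, M i)) :
    listProd (List.replicate n l).flatten = listProd l ^ n := by
  induction n with
  | zero => simp
  | succ n ih => simp [List.replicate_succ, ih, pow_succ']

theorem isReduced_nil : IsReduced ([] : List (Σ i, M i)) := by simp [IsReduced]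

theorem isReduced_singleton {x : Σ i, M i} : IsReduced [x] ↔ x.2 ≠ 1 := by simp [IsReduced]

theorem isReduced_append {l m : List (Σ i, M i)} :
    IsReduced (l ++ m) ↔ IsReduced l ∧ IsReduced m ∧
      ∀ x ∈ l.getLast?, ∀ y ∈ m.head?, x.1 ≠ y.1 := by
  simp only [IsReduced, List.isChain_append, List.mem_append]
  grind

theorem isReduced_cons {x : Σ i, M i} {l : List (Σ i, M i)} :
    IsReduced (x :: l) ↔ x.2 ≠ 1 ∧ IsReduced l ∧ ∀ y ∈ l.head?, x.1 ≠ y.1 := by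
  rw [← List.singleton_append, isReduced_append, isReduced_singleton]
  simp

theorem exists_isReduced (g : CoprodI M) : ∃ l, IsReduced l ∧ listProd l = g := by
  classical
  exact ⟨(Word.equiv g).toList, ⟨(Word.equiv g).ne_one, (Word.equiv g).chain_ne⟩,
    Word.equiv.symm_apply_apply g⟩

theorem IsReduced.eq_of_listProd_eq {l m : List (Σ i, M i)} (hl : IsReduced l)
    (hm : IsReduced m) (h : listProd l = listProd m) : l = m := by
  classical
  have : (⟨l, hl.1, hl.2⟩ : Word M) = ⟨m, hm.1, hm.2⟩ := Word.equiv.symm.injective h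
  exact congrArg Word.toList this

theorem head?_flatten_replicate {α : Type*} (n : ℕ) (l : List α) :
    ((List.replicate (n + 1) l).flatten).head? = l.head? := by
  cases l <;> simp [List.replicate_succ]

theorem getLast?_flatten_replicate {α : Type*} (n : ℕ) (l : List α) :
    ((List.replicate (n + 1) l).flatten).getLast? = l.getLast? := by
  rcases List.eq_nil_or_concat l with rfl | ⟨k, x, rfl⟩ <;> simp [List.replicate_succ']

theorem IsReduced.flatten_replicate {l : List (Σ i, M i)} (h : IsReduced (l ++ l)) (n : ℕ) :
    IsReduced (List.replicate n l).flatten := by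
  rw [isReduced_append] at h
  induction n with
  | zero => simpa using isReduced_nil
  | succ n ih =>
    rw [List.replicate_succ, List.flatten_cons, isReduced_append]
    refine ⟨h.1, ih, ?_⟩
    cases n with
    | zero => simp
    | succ n => rw [head?_flatten_replicate]; exact h.2.2

theorem eq_cons_append_singleton {α : Type*} (l : List α) :
    l = [] ∨ (∃ x, l = [x]) ∨ ∃ x k y, l = x :: (k ++ [y]) := by
  cases l with
  | nil => simp
  | cons x l =>
    rcases List.eq_nil_or_concat l with rfl | ⟨k, y, rfl⟩
    · simp
    · exact .inr (.inr ⟨x, k, y, by simp⟩)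

/-- Every reduced word is conjugate to a word of length at most one or to a cyclically reduced
word. -/
theorem IsReduced.exists_conj : ∀ (n : ℕ) (l : List (Σ i, M i)), l.length ≤ n → IsReduced l →
    ∃ h m, listProd l = h * listProd m * h⁻¹ ∧ IsReduced m ∧
      (m.length ≤ 1 ∨ IsReduced (m ++ m)) := by
  intro n
  induction n with
  | zero => exact fun l hn hl => ⟨1, l, by simp, hl, .inl (by omega)⟩
  | succ n ih =>
    intro l hn hl
    obtain rfl | ⟨x, rfl⟩ | ⟨⟨i, a⟩, k, ⟨j, b⟩, rfl⟩ := eq_cons_append_singleton l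
    · exact ⟨1, [], by simp, hl, by simp⟩
    · exact ⟨1, [x], by simp, hl, by simp⟩
    by_cases hij : j = i
    · subst hij
      have hl' := hl
      rw [isReduced_cons, isReduced_append] at hl'
      obtain ⟨ha, ⟨hk, hb, hkb⟩, hak⟩ := hl'
      -- Conjugation moves the last letter to the front, where it merges with the first, so the word
      -- gets shorter.
      have key : listProd (⟨j, a⟩ :: (k ++ [⟨j, b⟩])) =
          (of b)⁻¹ * listProd (⟨j, b * a⟩ :: k) * of b := by
        simp [mul_assoc]
      by_cases hba : b * a = 1
      · obtain ⟨h, m, h1, h2⟩ := ih k (by simp at hn; omega) hk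
        refine ⟨(of b)⁻¹ * h, m, ?_, h2⟩
        rw [key]
        simp [hba, h1, mul_assoc]
      · obtain ⟨h, m, h1, h2⟩ := ih (⟨j, b * a⟩ :: k) (by simp at hn ⊢; omega) (by
          rw [isReduced_cons]
          refine ⟨hba, hk, ?_⟩
          cases k <;> simp_all)
        refine ⟨(of b)⁻¹ * h, m, ?_, h2⟩
        rw [key, h1]
        simp [mul_assoc]
    · refine ⟨1, _, by simp, hl, .inr ?_⟩
      rw [isReduced_append]
      refine ⟨hl, hl, ?_⟩
      rw [← List.cons_append, List.getLast?_append]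
      simpa using hij

/-- A nontrivial power of a reduced word starts and ends in the same factors as the word. -/
theorem IsReduced.exists_pow : ∀ (n : ℕ) (l : List (Σ i, M i)), l.length ≤ n → IsReduced l →
    ∀ q : ℕ, ∃ m, IsReduced m ∧ listProd m = listProd l ^ q ∧
      (∀ z ∈ m.head?, ∃ w ∈ l.head?, z.1 = w.1) ∧
      (∀ z ∈ m.getLast?, ∃ w ∈ l.getLast?, z.1 = w.1) := by
  intro n
  induction n with
  | zero =>
    intro l hn hl q
    obtain rfl : l = [] := List.length_eq_zero_iff.mp (by omega)
    exact ⟨[], hl, by simp⟩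
  | succ n ih =>
    intro l hn hl q
    obtain rfl | ⟨x, rfl⟩ | ⟨⟨i, a⟩, k, ⟨j, b⟩, rfl⟩ := eq_cons_append_singleton l
    · exact ⟨[], hl, by simp⟩
    · by_cases hx : x.2 ^ q = 1
      · exact ⟨[], isReduced_nil, by simp [← map_pow, hx]⟩
      · exact ⟨[⟨x.1, x.2 ^ q⟩], isReduced_singleton.2 hx, by simp⟩
    cases q with
    | zero => exact ⟨[], isReduced_nil, by simp⟩
    | succ q =>
    by_cases hij : j = i
    · subst hij
      have hl' := hl
      rw [isReduced_cons, isReduced_append] at hl'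
      obtain ⟨ha, ⟨hk, hb, hkb⟩, hak⟩ := hl'
      have hak' : ∀ y ∈ k.head?, j ≠ y.1 := by cases k <;> simp_all
      have hkb' : ∀ y ∈ k.getLast?, y.1 ≠ j := by simpa using hkb
      have key : listProd (⟨j, a⟩ :: (k ++ [⟨j, b⟩])) =
          (of b)⁻¹ * listProd (⟨j, b * a⟩ :: k) * of b := by
        simp [mul_assoc]
      by_cases hba : b * a = 1
      · obtain ⟨m, hm, hmp, hm1, hm2⟩ := ih k (by simp at hn; omega) hk (q + 1)
        by_cases hnil : m = []
        · subst hnil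
          refine ⟨[], isReduced_nil, ?_, by simp, by simp⟩
          rw [key]
          have := conj_pow (i := q + 1) (a := (of b : CoprodI M)⁻¹) (b := listProd k)
          simp only [listProd_cons, hba, map_one, one_mul]
          rw [inv_inv] at this
          rw [this, ← hmp]
          simp
        refine ⟨⟨j, a⟩ :: (m ++ [⟨j, b⟩]), ?_, ?_, by simp, ?_⟩
        · rw [isReduced_cons, isReduced_append]
          refine ⟨ha, ⟨hm, hb, ?_⟩, ?_⟩
          · intro x hx y hy
            obtain ⟨w, hw, e⟩ := hm2 x hx
            rw [e]; exact hkb w hw y hy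
          · rw [List.head?_append_of_ne_nil _ hnil]
            intro x hx
            obtain ⟨w, hw, e⟩ := hm1 x hx
            rw [e]; exact hak' w hw
        · rw [key]
          have := conj_pow (i := q + 1) (a := (of b : CoprodI M)⁻¹) (b := listProd k)
          have hab : (of a : CoprodI M) = (of b)⁻¹ := by
            rw [← map_inv, eq_inv_of_mul_eq_one_right hba]
          simp only [listProd_cons, hba, map_one, one_mul]
          rw [inv_inv] at this
          rw [this, ← hmp, hab]
          simp [mul_assoc]
        · rw [← List.cons_append, List.getLast?_append, ← List.cons_append, List.getLast?_append]
          simp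
      · have hne : k ≠ [] := by rintro rfl; simp at hak
        have hc : IsReduced ((⟨j, b * a⟩ :: k) ++ (⟨j, b * a⟩ :: k)) := by
          have : IsReduced (⟨j, b * a⟩ :: k) := isReduced_cons.2 ⟨hba, hk, hak'⟩
          refine isReduced_append.2 ⟨this, this, ?_⟩
          rw [List.getLast?_cons_of_ne_nil hne]
          simpa using hkb
        obtain ⟨t, ht⟩ : ∃ t, (List.replicate q (⟨j, b * a⟩ :: k)).flatten = t := ⟨_, rfl⟩
        have hr := hc.flatten_replicate (q + 1)
        have hlast := getLast?_flatten_replicate q (⟨j, b * a⟩ :: k)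
        have hprod := listProd_flatten_replicate (q + 1) (⟨j, b * a⟩ :: k)
        rw [List.replicate_succ, List.flatten_cons, ht, List.cons_append] at hr hlast hprod
        rw [List.getLast?_cons_of_ne_nil hne, List.getLast?_cons_of_ne_nil (by simp [hne])]
          at hlast
        rw [isReduced_cons] at hr
        -- Conjugating the power back by `b` turns the leading `b * a` into `a` and appends `b`, so
        -- both end factors survive.
        refine ⟨⟨j, a⟩ :: ((k ++ t) ++ [⟨j, b⟩]), ?_, ?_, by simp, ?_⟩
        · rw [isReduced_cons, isReduced_append]
          refine ⟨ha, ⟨hr.2.1, hb, ?_⟩, ?_⟩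
          · rw [hlast]; exact hkb
          · rw [List.head?_append_of_ne_nil _ (by simp [hne])]
            exact hr.2.2
        · rw [key]
          have := conj_pow (i := q + 1) (a := (of b : CoprodI M)⁻¹)
            (b := listProd (⟨j, b * a⟩ :: k))
          rw [inv_inv] at this
          rw [this, ← hprod]
          simp [mul_assoc]
        · rw [← List.cons_append, List.getLast?_append, ← List.cons_append (bs := [_]),
            List.getLast?_append]
          simp
    · refine ⟨(List.replicate (q + 1) (⟨i, a⟩ :: (k ++ [⟨j, b⟩]))).flatten,
        IsReduced.flatten_replicate ?_ _, listProd_flatten_replicate _ _, ?_, ?_⟩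
      · rw [isReduced_append]
        refine ⟨hl, hl, ?_⟩
        rw [← List.cons_append, List.getLast?_append]
        simpa using hij
      · rw [head?_flatten_replicate]; exact fun z hz => ⟨z, hz, rfl⟩
      · rw [getLast?_flatten_replicate]; exact fun z hz => ⟨z, hz, rfl⟩

end Lists

theorem append_comm_of_flatten_replicate_eq {α : Type*} {l m : List α} {p q : ℕ}
    (hp : p ≠ 0) (hq : q ≠ 0)
    (h : (List.replicate p l).flatten = (List.replicate q m).flatten) : l ++ m = m ++ l := by
  obtain ⟨p, rfl⟩ := Nat.exists_eq_succ_of_ne_zero hp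
  obtain ⟨q, rfl⟩ := Nat.exists_eq_succ_of_ne_zero hq
  obtain ⟨w, hw⟩ : ∃ w, (List.replicate (p + 1) l).flatten = w := ⟨_, rfl⟩
  rw [hw] at h
  obtain ⟨u, hu⟩ : ∃ u, (List.replicate p l).flatten = u := ⟨_, rfl⟩
  obtain ⟨v, hv⟩ : ∃ v, (List.replicate q m).flatten = v := ⟨_, rfl⟩
  have h1 : w = l ++ u := by rw [← hw, List.replicate_succ, List.flatten_cons, hu]
  have h2 : w = u ++ l := by rw [← hw, List.replicate_succ', List.flatten_append, hu]; simp
  have h3 : w = m ++ v := by rw [h, List.replicate_succ, List.flatten_cons, hv]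
  have h4 : w = v ++ m := by rw [h, List.replicate_succ', List.flatten_append, hv]; simp
  -- Both `l ++ m` and `m ++ l` are prefixes of `w ++ w`, and they have equal length.
  have h5 : (l ++ m) ++ (v ++ u) = (m ++ l) ++ (u ++ v) := by
    calc (l ++ m) ++ (v ++ u) = l ++ (m ++ v) ++ u := by simp
      _ = l ++ (u ++ l) ++ u := by rw [← h3, ← h2]
      _ = (l ++ u) ++ (l ++ u) := by simp
      _ = (m ++ v) ++ (m ++ v) := by rw [← h1, ← h3]
      _ = m ++ (v ++ m) ++ v := by simp
      _ = m ++ (l ++ u) ++ v := by rw [← h4, ← h1]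
      _ = (m ++ l) ++ (u ++ v) := by simp
  exact (List.append_inj h5 (by simp [add_comm])).1

/-! ### Torsion and centralizers in free products -/

section Group

variable {ι : Type*} {M : ι → Type*} [∀ i, Group (M i)]

/-- An element of prime order in a free product has the order of an element of some factor. -/
theorem exists_orderOf_eq_of_pow_eq_one {g : CoprodI M} {p : ℕ} (hp : p.Prime) (hg : g ≠ 1)
    (h : g ^ p = 1) : ∃ i, ∃ a : M i, orderOf a = p := by
  obtain ⟨l, hl, rfl⟩ := exists_isReduced g
  obtain ⟨c, m, hc, hm, hm'⟩ := IsReduced.exists_conj _ l le_rfl hl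
  have hmp : listProd m ^ p = 1 := by
    rw [hc, conj_pow] at h
    exact conj_eq_one_iff.1 h
  have hm1 : m ≠ [] := by
    rintro rfl
    exact hg (by simp [hc])
  rcases hm' with hm' | hm'
  · obtain ⟨x, rfl⟩ : ∃ x, m = [x] := List.length_eq_one_iff.1
      (le_antisymm hm' (List.length_pos_iff.2 hm1))
    have := Fact.mk hp
    refine ⟨x.1, x.2, orderOf_eq_prime ?_ (isReduced_singleton.1 hm)⟩
    apply of_injective x.1
    simpa using hmp
  · have := (hm'.flatten_replicate p).eq_of_listProd_eq isReduced_nil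
      (by rw [listProd_flatten_replicate, hmp]; rfl)
    have := congrArg List.length this
    simp [hp.ne_zero, hm1] at this

/-- Left multiplication by a nontrivial letter always changes the first letter, whereas right
multiplication keeps it unless the word is a single letter of that factor. Comparing the two
determines centralizers. -/
theorem IsReduced.exists_of_mul {i : ι} {a : M i} (ha : a ≠ 1) {x : Σ i, M i}
    {k : List (Σ i, M i)} (h : IsReduced (x :: k)) :
    ∃ m, IsReduced m ∧ listProd m = of a * listProd (x :: k) ∧ m.head? ≠ some x := by
  obtain ⟨j, b⟩ := x
  by_cases hij : i = j
  · subst hij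
    rw [isReduced_cons] at h
    by_cases hab : a * b = 1
    · refine ⟨k, h.2.1, ?_, fun e => h.2.2 _ e rfl⟩
      rw [listProd_cons, ← mul_assoc, ← map_mul, hab, map_one, one_mul]
    · refine ⟨⟨i, a * b⟩ :: k, isReduced_cons.2 ⟨hab, h.2⟩, by simp [mul_assoc], ?_⟩
      simpa using ha
  · refine ⟨⟨i, a⟩ :: ⟨j, b⟩ :: k, isReduced_cons.2 ⟨ha, h, by simpa using hij⟩, by simp, ?_⟩
    simp [hij]

theorem IsReduced.exists_mul_of {i : ι} {a : M i} (ha : a ≠ 1) {x : Σ i, M i}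
    {k : List (Σ i, M i)} (h : IsReduced (x :: k)) (hx : k = [] → x.1 ≠ i) :
    ∃ m, IsReduced (x :: m) ∧ listProd (x :: m) = listProd (x :: k) * of a := by
  rcases List.eq_nil_or_concat k with rfl | ⟨k, ⟨j, b⟩, rfl⟩
  · refine ⟨[⟨i, a⟩], isReduced_cons.2 ⟨isReduced_singleton.1 h, isReduced_singleton.2 ha, ?_⟩,
      by simp⟩
    simpa using hx
  simp only [List.concat_eq_append] at h ⊢
  by_cases hij : j = i
  · subst hij
    rw [← List.cons_append, isReduced_append] at h
    by_cases hba : b * a = 1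
    · refine ⟨k, h.1, ?_⟩
      simp [mul_assoc, ← map_mul, hba]
    · refine ⟨k ++ [⟨j, b * a⟩], ?_, by simp [mul_assoc]⟩
      rw [← List.cons_append, isReduced_append]
      exact ⟨h.1, isReduced_singleton.2 hba, by simpa using h.2.2⟩
  · refine ⟨k ++ [⟨j, b⟩] ++ [⟨i, a⟩], ?_, by simp [mul_assoc]⟩
    rw [← List.cons_append, isReduced_append]
    refine ⟨h, isReduced_singleton.2 ha, ?_⟩
    rw [← List.cons_append, List.getLast?_append]
    simpa using hij

/-- An element of a free product commuting with a nontrivial element of a factor lies in that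
factor. -/
theorem exists_eq_of_of_commute {i : ι} {a : M i} (ha : a ≠ 1) {g : CoprodI M}
    (h : Commute (of a) g) : ∃ b : M i, g = of b := by
  obtain ⟨l, hl, rfl⟩ := exists_isReduced g
  rcases l with _ | ⟨x, k⟩
  · exact ⟨1, by simp⟩
  by_cases hx : k = [] → x.1 ≠ i
  · obtain ⟨m, hm, hmp, hmx⟩ := hl.exists_of_mul ha
    obtain ⟨n, hn, hnp⟩ := hl.exists_mul_of ha hx
    obtain rfl := hm.eq_of_listProd_eq hn (by rw [hmp, hnp, h.eq])
    simp at hmx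
  · push Not at hx
    obtain ⟨rfl, rfl⟩ := hx
    exact ⟨x.2, by simp⟩

end Group

/-! ### Common powers in free products of commutative groups -/

section CommGroup

variable {ι : Type*} {M : ι → Type*} [∀ i, CommGroup (M i)]

theorem commute_listProd_of_pow_eq_pow {m l : List (Σ i, M i)} (hm : IsReduced m)
    (hl : IsReduced l) (hm' : m.length ≤ 1 ∨ IsReduced (m ++ m)) {p q : ℕ} (hp : p ≠ 0)
    (hq : q ≠ 0) (h : listProd m ^ p = listProd l ^ q) (h1 : listProd m ^ p ≠ 1) :
    Commute (listProd m) (listProd l) := by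
  have hm1 : m ≠ [] := by
    rintro rfl
    simp at h1
  rcases hm' with hm' | hm'
  · obtain ⟨x, rfl⟩ : ∃ x, m = [x] := List.length_eq_one_iff.1
      (le_antisymm hm' (List.length_pos_iff.2 hm1))
    simp only [listProd_cons, listProd_nil, mul_one, ← map_pow] at h h1 ⊢
    obtain ⟨b, hb⟩ := exists_eq_of_of_commute (a := x.2 ^ p) (by rintro e; simp [e] at h1)
      (show Commute (of (x.2 ^ p)) (listProd l) from h ▸ (Commute.refl _).pow_left q)
    rw [hb]
    exact (Commute.all _ _).map of
  · obtain ⟨k, hk, hkp, hk1, hk2⟩ := hl.exists_pow _ l le_rfl q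
    obtain rfl := (hm'.flatten_replicate p).eq_of_listProd_eq hk
      (by rw [listProd_flatten_replicate, h, hkp])
    obtain ⟨p, rfl⟩ := Nat.exists_eq_succ_of_ne_zero hp
    rw [Nat.succ_eq_add_one, head?_flatten_replicate] at hk1
    rw [Nat.succ_eq_add_one, getLast?_flatten_replicate] at hk2
    -- The common power begins and ends in the factors of the ends of `m`, and also of `l`; these
    -- differ, so `l` is cyclically reduced too.
    have hll : IsReduced (l ++ l) := by
      refine isReduced_append.2 ⟨hl, hl, fun x hx y hy e => ?_⟩
      obtain ⟨z, hz, e1⟩ := hk1 _ (List.head?_eq_some_head hm1)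
      obtain ⟨w, hw, e2⟩ := hk2 _ (List.getLast?_eq_some_getLast hm1)
      obtain rfl : x = w := Option.some.inj (hx.symm.trans hw)
      obtain rfl : y = z := Option.some.inj (hy.symm.trans hz)
      exact (isReduced_append.1 hm').2.2 _ (List.getLast?_eq_some_getLast hm1) _
        (List.head?_eq_some_head hm1) (by rw [e1, e2, e])
    have := append_comm_of_flatten_replicate_eq hp hq
      ((hm'.flatten_replicate _).eq_of_listProd_eq (hll.flatten_replicate _)
        (by rw [listProd_flatten_replicate, listProd_flatten_replicate, h]))
    rw [commute_iff_eq, ← listProd_append, this, listProd_append]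

/-- In a free product of commutative groups, two elements with a common nontrivial power
commute. -/
theorem commute_of_pow_eq_pow {a b : CoprodI M} {p q : ℕ} (hp : p ≠ 0) (hq : q ≠ 0)
    (h : a ^ p = b ^ q) (h1 : a ^ p ≠ 1) : Commute a b := by
  obtain ⟨l, hl, rfl⟩ := exists_isReduced a
  obtain ⟨c, m, hc, hm, hm'⟩ := IsReduced.exists_conj _ l le_rfl hl
  obtain ⟨k, hk, hkp⟩ := exists_isReduced (c⁻¹ * b * c)
  obtain rfl : b = c * listProd k * c⁻¹ := by rw [hkp]; group
  rw [hc] at h h1 ⊢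
  rw [conj_pow, conj_pow] at h
  rw [conj_pow, Ne, conj_eq_one_iff] at h1
  exact (Commute.conj_iff c).2
    (commute_listProd_of_pow_eq_pow hm hk hm' hp hq (by simpa using h) h1)

end CommGroup

end Monoid.CoprodI

/-! ### Torus knot groups and their cyclic free product quotients -/

open Monoid (CoprodI)
open scoped commutatorElement

namespace TorusKnotGroup

/-- The homomorphism from a torus knot group given by two elements with a common power. -/
def lift {p q : ℕ} {G : Type*} [Group G] (a b : G) (h : a ^ p = b ^ q) :
    TorusKnotGroup p q →* G :=
  PresentedGroup.toGroup (f := ![a, b]) (by simp [h])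

section

variable {p q : ℕ} {G : Type*} [Group G] {a b : G} {h : a ^ p = b ^ q}

@[simp] theorem lift_of_zero : lift a b h (PresentedGroup.of 0) = a := by
  simp [lift]

@[simp] theorem lift_of_one : lift a b h (PresentedGroup.of 1) = b := by
  simp [lift]

end

theorem of_zero_pow (p q : ℕ) :
    (PresentedGroup.of 0 : TorusKnotGroup p q) ^ p = PresentedGroup.of 1 ^ q := by
  rw [← mul_inv_eq_one]
  exact PresentedGroup.one_of_mem (rels := {FreeGroup.of 0 ^ p * (FreeGroup.of 1 ^ q)⁻¹})
    (Set.mem_singleton _)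

theorem mem_center_iff {p q : ℕ} {z : TorusKnotGroup p q} :
    z ∈ Subgroup.center (TorusKnotGroup p q) ↔
      Commute z (PresentedGroup.of 0) ∧ Commute z (PresentedGroup.of 1) := by
  refine ⟨fun hz => ⟨(Subgroup.mem_center_iff.1 hz _).symm,
    (Subgroup.mem_center_iff.1 hz _).symm⟩, fun hz => Subgroup.mem_center_iff.2 fun g => ?_⟩
  have : g ∈ Subgroup.centralizer {z} := by
    refine PresentedGroup.generated_by _ _ (fun j => ?_) g
    rw [Subgroup.mem_centralizer_singleton_iff]
    fin_cases j
    · exact hz.1.symm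
    · exact hz.2.symm
  exact Subgroup.mem_centralizer_singleton_iff.1 this

theorem of_zero_pow_mem_center (p q : ℕ) :
    (PresentedGroup.of 0 : TorusKnotGroup p q) ^ p ∈ Subgroup.center (TorusKnotGroup p q) :=
  mem_center_iff.2 ⟨(Commute.refl _).pow_left p, of_zero_pow p q ▸ (Commute.refl _).pow_left q⟩

/-- The free product of the cyclic groups of orders `p` and `q`. -/
abbrev CyclicProd (p q : ℕ) : Type :=
  CoprodI fun i : Fin 2 => Multiplicative (ZMod (![p, q] i))

/-- The generators of the free product of two cyclic groups. -/
def gen (p q : ℕ) (i : Fin 2) : CyclicProd p q :=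
  CoprodI.of (i := i) (Multiplicative.ofAdd 1)

theorem gen_pow (p q : ℕ) (i : Fin 2) : gen p q i ^ (![p, q] i) = 1 := by
  rw [gen, ← map_pow, ← ofAdd_nsmul]
  simp

/-- The quotient map from a torus knot group to the free product of two cyclic groups. -/
def toCyclicProd (p q : ℕ) : TorusKnotGroup p q →* CyclicProd p q :=
  lift (gen p q 0) (gen p q 1) ((gen_pow p q 0).trans (gen_pow p q 1).symm)

theorem toCyclicProd_of (p q : ℕ) (i : Fin 2) :
    toCyclicProd p q (PresentedGroup.of i) = gen p q i := by
  fin_cases i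
  · exact lift_of_zero
  · exact lift_of_one

theorem not_commute_of {p q : ℕ} (hp : p.Prime) (hq : q.Prime) :
    ¬ Commute (PresentedGroup.of 0 : TorusKnotGroup p q) (PresentedGroup.of 1) := by
  intro h
  have h2 : Commute (gen p q 0) (gen p q 1) := by
    rw [← toCyclicProd_of, ← toCyclicProd_of]
    exact h.map (toCyclicProd p q)
  have hne : ∀ i : Fin 2, (Multiplicative.ofAdd 1 : Multiplicative (ZMod (![p, q] i))) ≠ 1 := by
    intro i
    have : Fact (1 < ![p, q] i) := ⟨by fin_cases i; exacts [hp.one_lt, hq.one_lt]⟩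
    rw [Ne, ofAdd_eq_one]
    exact one_ne_zero
  -- Commuting would put the second generator into the first factor, against uniqueness of reduced
  -- words.
  obtain ⟨b, hb⟩ := CoprodI.exists_eq_of_of_commute (hne 0) h2
  have hb1 : b ≠ 1 := by
    rintro rfl
    rw [map_one] at hb
    exact hne 1 (CoprodI.of_injective 1 (hb.trans (map_one _).symm))
  have := CoprodI.IsReduced.eq_of_listProd_eq
    (M := fun i : Fin 2 => Multiplicative (ZMod (![p, q] i)))
    (l := [⟨1, Multiplicative.ofAdd 1⟩]) (m := [⟨0, b⟩])
    (CoprodI.isReduced_singleton.2 (hne 1)) (CoprodI.isReduced_singleton.2 hb1)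
    (by simpa [gen] using hb)
  exact one_ne_zero (congrArg Sigma.fst (List.singleton_inj.1 this))

/-- The homomorphism from a cyclic group given by an element of finite order. -/
def zmodHom {G : Type*} [Group G] (n : ℕ) (g : G) (h : g ^ n = 1) :
    Multiplicative (ZMod n) →* G :=
  AddMonoidHom.toMultiplicativeLeft
    (ZMod.lift n ⟨zmultiplesHom (Additive G) (Additive.ofMul g), by
      simpa using congrArg Additive.ofMul h⟩)

theorem zmodHom_ofAdd_one {G : Type*} [Group G] (n : ℕ) (g : G) (h : g ^ n = 1) :
    zmodHom n g h (Multiplicative.ofAdd 1) = g := by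
  have := ZMod.lift_coe n ⟨zmultiplesHom (Additive G) (Additive.ofMul g), by
      simpa using congrArg Additive.ofMul h⟩ 1
  simp at this
  simp [zmodHom, this]

/-- The quotient by the center kills both generator powers, so it factors through `toCyclicProd`. -/
theorem mem_center_of_toCyclicProd_eq_one {p q : ℕ} {g : TorusKnotGroup p q}
    (hg : toCyclicProd p q g = 1) : g ∈ Subgroup.center (TorusKnotGroup p q) := by
  set π := QuotientGroup.mk' (Subgroup.center (TorusKnotGroup p q))
  have h : ∀ i : Fin 2, π (PresentedGroup.of i) ^ (![p, q] i) = 1 := by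
    intro i
    rw [← map_pow, ← MonoidHom.mem_ker, QuotientGroup.ker_mk']
    fin_cases i
    · exact of_zero_pow_mem_center p q
    · exact of_zero_pow p q ▸ of_zero_pow_mem_center p q
  have key : (CoprodI.lift fun i => zmodHom _ _ (h i)).comp (toCyclicProd p q) = π := by
    refine PresentedGroup.ext fun i => ?_
    rw [MonoidHom.comp_apply, toCyclicProd_of]
    exact (CoprodI.lift_of _ _).trans (zmodHom_ofAdd_one _ _ _)
  rw [← QuotientGroup.ker_mk' (Subgroup.center (TorusKnotGroup p q)), MonoidHom.mem_ker]
  change π g = 1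
  rw [← key, MonoidHom.comp_apply, hg, map_one]

theorem eq_or_eq_of_orderOf {r s p : ℕ} (hr : r.Prime) (hs : s.Prime) (hp : p.Prime)
    {g : CyclicProd r s} (hg : g ≠ 1) (h : g ^ p = 1) : p = r ∨ p = s := by
  obtain ⟨i, a, ha⟩ := CoprodI.exists_orderOf_eq_of_pow_eq_one hp hg h
  have hdvd : p ∣ ![r, s] i := by
    rw [← ha]
    refine orderOf_dvd_of_pow_eq_one (Multiplicative.toAdd.injective ?_)
    simp
  fin_cases i
  · exact .inl ((Nat.prime_dvd_prime_iff_eq hp hr).1 hdvd)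
  · exact .inr ((Nat.prime_dvd_prime_iff_eq hp hs).1 hdvd)

end TorusKnotGroup

/-! ### The embedding argument -/

/-- If the commutator of `x` and `y` is central and coprime powers of `x` and `y` are central,
then `x` and `y` commute. -/
theorem commute_of_commutator_mem_center {G : Type*} [Group G] {x y : G} {p q : ℕ}
    (hpq : p.Coprime q) (hx : x ^ p ∈ Subgroup.center G) (hy : y ^ q ∈ Subgroup.center G)
    (h : ⁅x, y⁆ ∈ Subgroup.center G) : Commute x y := by
  have hc : ∀ g, Commute ⁅x, y⁆ g := fun g => (Subgroup.mem_center_iff.1 h g).symm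
  have key : ∀ n : ℕ, y * x ^ n * y⁻¹ = ⁅x, y⁆⁻¹ ^ n * x ^ n := fun n => by
    rw [← conj_pow, ← ((hc x).inv_left).mul_pow]
    simp [commutatorElement_def, mul_assoc]
  have key' : ∀ n : ℕ, x * y ^ n * x⁻¹ = ⁅x, y⁆ ^ n * y ^ n := fun n => by
    rw [← conj_pow, ← (hc y).mul_pow]
    simp [commutatorElement_def, mul_assoc]
  -- Conjugation by `y` fixes the central `x ^ p` but multiplies it by the inverse of this power.
  have h1 : ⁅x, y⁆ ^ p = 1 := by
    have := key p
    rw [Subgroup.mem_center_iff.1 hx y, mul_inv_cancel_right] at this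
    exact inv_eq_one.1 ((inv_pow _ _).symm.trans (right_eq_mul.1 this))
  have h2 : ⁅x, y⁆ ^ q = 1 := by
    have := key' q
    rw [Subgroup.mem_center_iff.1 hy x, mul_inv_cancel_right] at this
    simpa using this
  have h3 : ⁅x, y⁆ = 1 := by
    rw [← orderOf_eq_one_iff]
    exact Nat.eq_one_of_dvd_coprimes hpq (orderOf_dvd_of_pow_eq_one h1)
      (orderOf_dvd_of_pow_eq_one h2)
  exact commutatorElement_eq_one_iff_mul_comm.1 h3

theorem lemma4p1 (p q r s : ℕ) (hp : p.Prime) (hq : q.Prime) (hr : r.Prime) (hs : s.Prime)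
    (hpq : p < q) (hrs : r < s) :
    (∃ f : TorusKnotGroup p q →* TorusKnotGroup r s, Function.Injective f) ↔
      (p = r ∧ q = s) := by
  refine ⟨?_, ?_⟩
  swap
  · rintro ⟨rfl, rfl⟩
    exact ⟨MonoidHom.id _, Function.injective_id⟩
  rintro ⟨f, hf⟩
  obtain ⟨x, hx⟩ : ∃ x : TorusKnotGroup p q, PresentedGroup.of 0 = x := ⟨_, rfl⟩
  obtain ⟨y, hy⟩ : ∃ y : TorusKnotGroup p q, PresentedGroup.of 1 = y := ⟨_, rfl⟩
  have hxy : ¬ Commute x y := hx ▸ hy ▸ TorusKnotGroup.not_commute_of hp hq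
  have hpow : x ^ p = y ^ q := hx ▸ hy ▸ TorusKnotGroup.of_zero_pow p q
  have hcen : x ^ p ∈ Subgroup.center (TorusKnotGroup p q) :=
    hx ▸ TorusKnotGroup.of_zero_pow_mem_center p q
  set φ := (TorusKnotGroup.toCyclicProd r s).comp f with hφ
  have hker : ∀ g, φ g = 1 → g ∈ Subgroup.center (TorusKnotGroup p q) := fun g hg =>
    Subgroup.mem_center_iff.2 fun k => hf <| by
      simpa using Subgroup.mem_center_iff.1
        (TorusKnotGroup.mem_center_of_toCyclicProd_eq_one (g := f g) hg) (f k)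
  have hφpow : φ x ^ p = φ y ^ q := by rw [← map_pow, ← map_pow, hpow]
  have h1 : φ x ^ p = 1 := by
    by_contra h1
    have hcomm := CoprodI.commute_of_pow_eq_pow hp.ne_zero hq.ne_zero hφpow h1
    refine hxy (commute_of_commutator_mem_center ((Nat.coprime_primes hp hq).2 hpq.ne) hcen
      (hpow ▸ hcen) (hker _ ?_))
    rw [map_commutatorElement, commutatorElement_eq_one_iff_mul_comm]
    exact hcomm
  have hx1 : φ x ≠ 1 := fun h => hxy (Subgroup.mem_center_iff.1 (hker x h) y).symm
  have hy1 : φ y ≠ 1 := fun h => hxy (Subgroup.mem_center_iff.1 (hker y h) x)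
  have hpr := TorusKnotGroup.eq_or_eq_of_orderOf hr hs hp hx1 h1
  have hqs := TorusKnotGroup.eq_or_eq_of_orderOf hr hs hq hy1 (hφpow ▸ h1)
  omega
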